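/- \textbf{Setting.} A projective geometry is an axiomatic one: any two points lie on a unique line, every line has at least three points, and for noncollinear $p,q,r$ with $p'\in qr$, $q'\in pr$ the lines $pp'$ and $qq'$ meet; subspaces are the line-closed point sets and hyperplanes are the maximal proper subspaces. No finiteness of dimension is assumed. An affine geometry $\mathbb A=\mathbb P\setminus h_\infty$ is a projective geometry $\mathbb P$ with a hyperplane $h_\infty$ removed; its hyperplanes are the sets $H\setminus h_\infty$ with $H\neq h_\infty$ a hyperplane of $\mathbb P$. Let $\mathcal A=\{h_e:e\in E\}$ be a family of distinct hyperplanes of $\mathbb A$, let $(h_e)_{\mathbb P}$ be the projective closure of $h_e$, and let $\mathcal A_{\mathbb P}=\{(h_e)_{\mathbb P}:e\in E\}\cup\{h_\infty\}$. Let $\mathcal A_\infty$ be the set of ideal parts $(h_e)_{\mathbb P}\cap h_\infty$, with its finitary matroid as a set of hyperplanes of $h_\infty$: a set of them is independent if, in each of its finite subsets, no member contains the intersection (within $h_\infty$) of the others. Suppose $\mathcal A$ is synthetic affinographic: there are a graph $\Delta$, possibly infinite, whose edges are links, and a bijection $\mathcal A_\infty\to E(\Delta)$ that is an isomorphism of this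 matroid with the graphic matroid $G(\Delta)$. Write $p(e)$ for the edge of $\Delta$ that corresponds to the ideal part of $h_e$. Let $\Omega(\mathcal A)$ have the nodes of $\Delta$ and edge set $E$, the edge $e$ having the endpoints of $p(e)$. Call a circle $C$ of this graph balanced if it is not a digon and $\bigcap_{e\in C}h_e\neq\varnothing$; an edge set is balanced if every circle in it is balanced. For $S\subseteq E$ let $\operatorname{bcl}S$ be $S$ together with all $e$ for which there is a balanced circle $C$ with $e\in C\subseteq S\cup\{e\}$, and let $\operatorname{clos}S$ be the closure of $S$ in the graphic matroid of the underlying graph. $\operatorname{Lat}_b\Omega(\mathcal A)$ is the set of balanced $S$ with $\operatorname{bcl}S=S$. $\operatorname{Lat}L_0(\Omega(\mathcal A))$ is the set of closed sets of the extended lift matroid $L_0(\Omega(\mathcal A))$ on $E\cup\{e_0\}$, whose closure operator is $S\mapsto\operatorname{bcl}S$ if $e_0\notin S$ and $S$ is balanced, and $S\mapsto\operatorname{clos}(S\cap E)\cup\{e_0\}$ otherwise. Both are ordered by inclusion. $\mathcal L(\mathcal A)$ is the set of nonempty intersections (in $\mathbb A$) of subfamilies of $\mathcal A$, and $\mathcal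 L(\mathcal A_{\mathbb P})$ is the set of all intersections (in $\mathbb P$) of subfamilies of $\mathcal A_{\mathbb P}$; both are ordered by reverse inclusion. \textbf{Theorem.} (1) $\Omega(\mathcal A)$ is a biased graph: no theta subgraph contains exactly two balanced circles. (2) For every finite $S\subseteq E$, $\bigcap_{e\in S}h_e$ (taken to be $\mathbb A$ if $S=\varnothing$) is nonempty if and only if $S$ is balanced. (3) Under $(h_e)_{\mathbb P}\mapsto e$, $h_\infty\mapsto e_0$, the finitary matroid of $\mathcal A_{\mathbb P}$ is $L_0(\Omega(\mathcal A))$: for every finite $S\subseteq E\cup\{e_0\}$, a member of $\mathcal A_{\mathbb P}$ contains the intersection of the members corresponding to $S$ if and only if its element lies in the $L_0$-closure of $S$. (4) Suppose moreover that $\mathcal A_{\mathbb P}$ is finitary, i.e. whenever a member of $\mathcal A_{\mathbb P}$ contains the intersection of a subfamily, it contains the intersection of a finite part of that subfamily (this always holds if $\mathbb A$ has finite dimension or $\mathcal A$ is finite). Then (2) holds for every $S\subseteq E$; $t\mapsto\{e\in E:t\subseteq h_e\}$ is an order isomorphism $\mathcal L(\mathcal A)\cong\operatorname{Lat}_b\Omega(\mathcal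 A)$ with inverse $S\mapsto\bigcap_{e\in S}h_e$; and the map that sends $t$ to the set of elements of $E\cup\{e_0\}$ whose hyperplanes in $\mathcal A_{\mathbb P}$ contain $t$ is an order isomorphism $\mathcal L(\mathcal A_{\mathbb P})\cong\operatorname{Lat}L_0(\Omega(\mathcal A))$, with $e\leftrightarrow(h_e)_{\mathbb P}$ and $e_0\leftrightarrow h_\infty$, whose inverse sends $S$ to the intersection of the corresponding hyperplanes. -/

import Mathlib

/-! ### Axiomatic projective and affine geometry -/

/-- An axiomatic projective geometry on the point set `P`. The empty geometry and a single
point (with no lines) are allowed, and the dimension may be infinite. -/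
structure ProjectiveGeometry (P : Type*) where
  lines : Set (Set P)
  existsUnique_line : ∀ p q : P, p ≠ q → ∃! l : Set P, l ∈ lines ∧ p ∈ l ∧ q ∈ l
  three_points : ∀ l ∈ lines, ∃ a ∈ l, ∃ b ∈ l, ∃ c ∈ l, a ≠ b ∧ a ≠ c ∧ b ≠ c
  /-- For noncollinear `p, q, r`, if `p'` lies on `qr` and `q'` on `pr`,
  then the lines `pp'` and `qq'` meet. -/
  veblen : ∀ p q r p' q' : P, (¬ ∃ l ∈ lines, p ∈ l ∧ q ∈ l ∧ r ∈ l) →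
    (∃ l ∈ lines, q ∈ l ∧ r ∈ l ∧ p' ∈ l) → (∃ l ∈ lines, p ∈ l ∧ r ∈ l ∧ q' ∈ l) →
    ∀ m ∈ lines, ∀ n ∈ lines, p ∈ m → p' ∈ m → q ∈ n → q' ∈ n → (m ∩ n).Nonempty

namespace ProjectiveGeometry

variable {P : Type*} (G : ProjectiveGeometry P)

/-- A subspace is a line-closed set of points. -/
def IsSubspace (T : Set P) : Prop :=
  ∀ l ∈ G.lines, ∀ p ∈ l, ∀ q ∈ l, p ≠ q → p ∈ T → q ∈ T → l ⊆ T

/-- The smallest subspace that contains `S`. -/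
def span (S : Set P) : Set P := ⋂₀ {T | G.IsSubspace T ∧ S ⊆ T}

/-- A hyperplane is a maximal proper subspace. -/
def IsHyperplane (H : Set P) : Prop :=
  G.IsSubspace H ∧ H ≠ Set.univ ∧
    ∀ T : Set P, G.IsSubspace T → H ⊆ T → T = H ∨ T = Set.univ

end ProjectiveGeometry

/-- An axiomatic affine geometry: a projective geometry (its projective completion, with point
set `P`) from which a hyperplane, the ideal hyperplane `hInf`, is removed. The points of the
affine geometry are the points of `hInfᶜ`. -/
structure AffineGeometry (P : Type*) extends ProjectiveGeometry P where
  hInf : Set P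
  isHyperplane_hInf : toProjectiveGeometry.IsHyperplane hInf

/-- The hyperplanes of the affine geometry are the ordinary parts of the projective hyperplanes
other than the ideal one. -/
def AffineGeometry.IsAffineHyperplane {P : Type*} (A : AffineGeometry P) (a : Set P) : Prop :=
  ∃ H : Set P, A.IsHyperplane H ∧ H ≠ A.hInf ∧ a = H \ A.hInf

/-- Independence in the (finitary) matroid of a set `F` of hyperplanes of a geometry with point
set `X`: in no finite subset of `F` does a member contain the intersection of the others.
Equivalently, the members of `F` are independent points of the dual geometry. -/
def IndepHyperplanes {P : Type*} (X : Set P) (F : Set (Set P)) : Prop :=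
  ∀ F₀ ⊆ F, F₀.Finite → ∀ a ∈ F₀, ¬ (X ∩ ⋂₀ (F₀ \ {a}) ⊆ a)

/-! ### Graphs and biased graphs -/

namespace Graph

variable {N E B : Type*}

/-- `W` and `S` are the node set and the edge set of a path from `x` to `y`
(without repeated nodes) in `Γ`. -/
def IsPathFromTo (Γ : Graph N E) (x y : N) (W : Set N) (S : Set E) : Prop :=
  ∃ (n : ℕ) (v : Fin (n + 1) → N) (e : Fin n → E), Function.Injective v ∧
    v 0 = x ∧ v (Fin.last n) = y ∧ (∀ i, v i ∈ Γ.vertexSet) ∧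
    (∀ i : Fin n, Γ.IsLink (e i) (v i.castSucc) (v i.succ)) ∧
    W = Set.range v ∧ S = Set.range e

/-- A circle is the edge set of a simple closed path `v₀ e₀ v₁ e₁ ⋯ vₙ₋₁ eₙ₋₁ v₀` with `n ≥ 1`. -/
def IsCircle (Γ : Graph N E) (C : Set E) : Prop :=
  ∃ (n : ℕ) (v : ZMod (n + 1) → N) (e : ZMod (n + 1) → E), Function.Injective v ∧
    Function.Injective e ∧ (∀ i, Γ.IsLink (e i) (v i) (v (i + 1))) ∧ C = Set.range e

/-- An edge set is a forest (it is independent in the graphic matroid) if it contains no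
circle. -/
def IsForest (Γ : Graph N E) (S : Set E) : Prop :=
  S ⊆ Γ.edgeSet ∧ ∀ C ⊆ S, ¬ Γ.IsCircle C

/-- The closure operator of the graphic matroid: add each edge whose endpoints are joined by a
path in `S`. -/
def clos (Γ : Graph N E) (S : Set E) : Set E :=
  S ∪ {e | ∃ x y W Q, Γ.IsLink e x y ∧ Γ.IsPathFromTo x y W Q ∧ Q ⊆ S}

/-- `P`, `Q`, `R` are the edge sets of three internally disjoint paths with the same two
endpoints. Their union is a theta graph, whose circles are `P ∪ Q`, `Q ∪ R` and `P ∪ R`. -/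
def IsTheta (Γ : Graph N E) (P Q R : Set E) : Prop :=
  ∃ (x y : N) (U V W : Set N), x ≠ y ∧
    Γ.IsPathFromTo x y U P ∧ Γ.IsPathFromTo x y V Q ∧ Γ.IsPathFromTo x y W R ∧
    U ∩ V = {x, y} ∧ V ∩ W = {x, y} ∧ U ∩ W = {x, y} ∧
    Disjoint P Q ∧ Disjoint Q R ∧ Disjoint P R

/-- `(Γ, 𝓑)` is a biased graph: `𝓑` is a class of circles such that no theta subgraph has
exactly two of its three circles in `𝓑`. (The paths `P`, `Q`, `R` can be listed in any order.) -/
def IsBiased (Γ : Graph N E) (𝓑 : Set (Set E)) : Prop :=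
  (∀ C ∈ 𝓑, Γ.IsCircle C) ∧
    ∀ P Q R, Γ.IsTheta P Q R → P ∪ Q ∈ 𝓑 → Q ∪ R ∈ 𝓑 → P ∪ R ∈ 𝓑

/-- An edge set is balanced if every circle in it belongs to `𝓑` (there are no half edges). -/
def Balanced (Γ : Graph N E) (𝓑 : Set (Set E)) (S : Set E) : Prop :=
  ∀ C ⊆ S, Γ.IsCircle C → C ∈ 𝓑

/-- The balance-closure of an edge set. -/
def bcl (𝓑 : Set (Set E)) (S : Set E) : Set E :=
  S ∪ {e | ∃ C ∈ 𝓑, e ∈ C ∧ C ⊆ S ∪ {e}}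

/-- The semilattice `Lat_b` of closed, balanced edge sets, ordered by inclusion. (The closure of
a balanced set is its balance-closure.) -/
def LatB (Γ : Graph N E) (𝓑 : Set (Set E)) : Set (Set E) :=
  {S | Γ.Balanced 𝓑 S ∧ bcl 𝓑 S = S}

open Classical in
/-- The closure operator of the extended lift matroid `L₀` of `(Γ, 𝓑)`. The ground set is
`Option E`, in which `none` is the extra element `e₀`. -/
noncomputable def closL0 (Γ : Graph N E) (𝓑 : Set (Set E)) (S : Set (Option E)) :
    Set (Option E) :=
  if none ∉ S ∧ Γ.Balanced 𝓑 (some ⁻¹' S) then some '' bcl 𝓑 (some ⁻¹' S)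
  else insert none (some '' Γ.clos (some ⁻¹' S))

/-- The lattice of closed sets of the extended lift matroid, ordered by inclusion. -/
def LatL0 (Γ : Graph N E) (𝓑 : Set (Set E)) : Set (Set (Option E)) :=
  {S | Γ.closL0 𝓑 S = S}

/-- The graph with the nodes of `Δ` in which every edge `b` of `Δ` is replaced by one edge for
each `e` with `p e = b`, with the same endpoints. -/
def pullback (Δ : Graph N B) (p : E → B) : Graph N E where
  vertexSet := Δ.vertexSet
  IsLink e x y := Δ.IsLink (p e) x y
  isLink_symm _ _ := ⟨fun _ _ h => Graph.IsLink.symm h⟩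
  eq_or_eq_of_isLink_of_isLink _ _ _ _ _ h h' := Δ.eq_or_eq_of_isLink_of_isLink h h'
  left_mem_of_isLink _ _ _ h := Δ.left_mem_of_isLink h

end Graph

/-! ### Hyperplane arrangements -/

/-- A family of distinct hyperplanes `h e`, `e ∈ E`, of the affine geometry `A`. -/
structure HyperplaneArrangement {P : Type*} (A : AffineGeometry P) (E : Type*) where
  h : E → Set P
  isAffineHyperplane : ∀ e, A.IsAffineHyperplane (h e)
  injective : Function.Injective h

namespace HyperplaneArrangement

variable {P E N B : Type*} {A : AffineGeometry P} (𝒜 : HyperplaneArrangement A E)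

/-- The projectivization `𝒜_ℙ`: the projective closures of the members of `𝒜`, together with
the ideal hyperplane, which is indexed by `none`. -/
def hP : Option E → Set P
  | none => A.hInf
  | some e => A.span (𝒜.h e)

/-- The ideal part of the hyperplane `h e`, a hyperplane of the ideal hyperplane. -/
def ideal (e : E) : Set P := 𝒜.hP (some e) ∩ A.hInf

/-- The family `𝒜_∞` of ideal parts; each parallel class of `𝒜` gives one member. -/
def idealFamily : Set (Set P) := Set.range 𝒜.ideal

/-- The intersection in the affine geometry of the members with index in `S`
(the whole affine geometry if `S` is empty). -/
def tA (S : Set E) : Set P := A.hInfᶜ ∩ ⋂ e ∈ S, 𝒜.h e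

/-- The intersection in the projective geometry of the members of `𝒜_ℙ` with index in `S`. -/
def tP (S : Set (Option E)) : Set P := ⋂ x ∈ S, 𝒜.hP x

/-- The intersection semilattice `𝓛(𝒜)`: the nonempty intersections of subfamilies. -/
def affineFlats : Set (Set P) := {t | t.Nonempty ∧ ∃ S, t = 𝒜.tA S}

/-- The intersection lattice `𝓛(𝒜_ℙ)`: all intersections of subfamilies. -/
def projFlats : Set (Set P) := {t | ∃ S, t = 𝒜.tP S}

/-- `ε` is an isomorphism from the matroid of `𝒜_∞` (hyperplanes in the projective geometry
`hInf`) onto the graphic matroid of `Δ`. -/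
def IsGraphicVia (Δ : Graph N B) (ε : Set P → B) : Prop :=
  Set.BijOn ε 𝒜.idealFamily Δ.edgeSet ∧
    ∀ F ⊆ 𝒜.idealFamily, IndepHyperplanes A.hInf F ↔ Δ.IsForest (ε '' F)

/-- The underlying graph of `Ω(𝒜)`: each edge of `Δ` is replaced by one edge for each member of
the corresponding parallel class. -/
def omegaGraph (Δ : Graph N B) (ε : Set P → B) : Graph N E :=
  Δ.pullback fun e => ε (𝒜.ideal e)

/-- The balanced circles of `Ω(𝒜)`: digons are unbalanced, and any other circle is balanced if
and only if its hyperplanes have nonempty intersection. -/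
def omegaBalanced (Δ : Graph N B) (ε : Set P → B) : Set (Set E) :=
  {C | (𝒜.omegaGraph Δ ε).IsCircle C ∧ C.encard ≠ 2 ∧ (𝒜.tA C).Nonempty}

/-- The matroid of `𝒜_ℙ` is finitary: if a member contains the intersection of a subfamily,
then it contains the intersection of a finite part of that subfamily. This holds whenever the
geometry has finite dimension and whenever `𝒜` is finite. -/
def Finitary : Prop :=
  ∀ (S : Set (Option E)) (x : Option E), 𝒜.tP S ⊆ 𝒜.hP x →
    ∃ F ⊆ S, F.Finite ∧ 𝒜.tP F ⊆ 𝒜.hP x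

end HyperplaneArrangement

/-! Read the members of `𝒜_ℙ` as points of a dual geometry: `x` is in the closure of `S` when `tP S
⊆ hP x`. Because every line meets every hyperplane, this closure has the exchange property
(`IsHyperplane.exchange`, `tP_exchange`). Two facts then determine it.

Contracting `none`, that is, intersecting with `hInf`, leaves the matroid of the ideal parts with
parallel elements allowed. By hypothesis it is graphic, so `e` is in the closure of `S ∪ {none}`
exactly when `e ∈ clos S` (`IsGraphicVia.tP_subset_iff_mem_clos`). Also, `tA S` is nonempty exactly
when `none` is not in the closure of `S`; in particular, a circle is balanced when its closure omits
`none`.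

The rest is exchange between `none` and an edge. An edge of a balanced circle lies in the closure of
the other edges, and an edge that completes no circle cannot bring `none` into the closure. Adding
edges one at a time gives the criterion for nonempty intersection, and from it the closure formula
of `L₀`. The theta property comes from adding the third path to a balanced circle: only its last
edge completes a circle, and the second balanced circle controls that edge.

Graphic closure is finitary, so `Finitary` carries these results over to infinite families. The
lattice isomorphisms are then the Galois correspondence between flats and closed index sets. -/

namespace ProjectiveGeometry

/-! ### Subspaces and hyperplanes of a projective geometry -/

variable {P : Type*} (G : ProjectiveGeometry P)

theorem eq_of_mem_lines {l m : Set P} (hl : l ∈ G.lines) (hm : m ∈ G.lines) {p q : P}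
    (hpq : p ≠ q) (hpl : p ∈ l) (hql : q ∈ l) (hpm : p ∈ m) (hqm : q ∈ m) : l = m :=
  (G.existsUnique_line p q hpq).unique ⟨hl, hpl, hql⟩ ⟨hm, hpm, hqm⟩

theorem exists_line {p q : P} (hpq : p ≠ q) : ∃ l ∈ G.lines, p ∈ l ∧ q ∈ l :=
  (G.existsUnique_line p q hpq).exists

theorem exists_third_point {l : Set P} (hl : l ∈ G.lines) (p q : P) :
    ∃ r ∈ l, r ≠ p ∧ r ≠ q := by
  obtain ⟨a, ha, b, hb, c, hc, hab, hac, hbc⟩ := G.three_points l hl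
  by_cases h1 : a ≠ p ∧ a ≠ q
  · exact ⟨a, ha, h1⟩
  by_cases h2 : b ≠ p ∧ b ≠ q
  · exact ⟨b, hb, h2⟩
  refine ⟨c, hc, ?_⟩
  grind

/-- If the lines `ab` and `cd` meet in a point, then so do the lines `ac` and `bd`. -/
theorem lines_meet {l₁ l₂ m n : Set P} (h₁ : l₁ ∈ G.lines) (h₂ : l₂ ∈ G.lines)
    (hm : m ∈ G.lines) (hn : n ∈ G.lines) (hne : l₁ ≠ l₂) {a b c d r : P}
    (ha : a ∈ l₁) (hb : b ∈ l₁) (hr₁ : r ∈ l₁) (hc : c ∈ l₂) (hd : d ∈ l₂) (hr₂ : r ∈ l₂)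
    (har : a ≠ r) (hdr : d ≠ r) (ham : a ∈ m) (hcm : c ∈ m) (hbn : b ∈ n) (hdn : d ∈ n) :
    (m ∩ n).Nonempty := by
  -- The triangle is `a`, `d`, `r`, with `c` on the side `dr` and `b` on the side `ar`.
  refine G.veblen a d r c b ?_ ⟨l₂, h₂, hd, hr₂, hc⟩ ⟨l₁, h₁, ha, hr₁, hb⟩ m hm n hn ham hcm hdn hbn
  rintro ⟨l, hl, hal, hdl, hrl⟩
  exact hne ((G.eq_of_mem_lines h₁ hl har ha hr₁ hal hrl).trans
    (G.eq_of_mem_lines hl h₂ hdr hdl hrl hd hr₂))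

variable {G}

/-- The union of the lines that join `p` to the points of a subspace. -/
theorem IsSubspace.isSubspace_cone {H : Set P} (hH : G.IsSubspace H) {p : P} (hp : p ∉ H) :
    G.IsSubspace (H ∪ {x | x = p ∨ ∃ h ∈ H, ∃ l ∈ G.lines, p ∈ l ∧ h ∈ l ∧ x ∈ l}) := by
  -- The main case: `x` and `y` lie on lines from `p` to `h` and `k`, and `z` lies on `xy`. Two uses
  -- of `lines_meet` show that `pz` meets `hk`, which lies in `H`. The requirement `x ≠ h` is
  -- harmless: either `x` and `y` can be interchanged, or both lie in `H`.
  have key : ∀ x h y k z, h ∈ H → k ∈ H → ∀ l₁ ∈ G.lines, ∀ l₂ ∈ G.lines, ∀ l ∈ G.lines,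
      p ∈ l₁ → h ∈ l₁ → x ∈ l₁ → p ∈ l₂ → k ∈ l₂ → y ∈ l₂ → x ≠ y → x ≠ p → y ≠ p → x ≠ h →
      x ∈ l → y ∈ l → z ∈ l → z ≠ p →
      ∃ h ∈ H, ∃ l ∈ G.lines, p ∈ l ∧ h ∈ l ∧ z ∈ l := by
    intro x h y k z hh hk l₁ h₁ l₂ h₂ l hl hp₁ hh₁ hx₁ hp₂ hk₂ hy₂ hxy hxp hyp hxh hx hy hz hzp
    have hph : p ≠ h := fun e => hp (e ▸ hh)
    have hpk : p ≠ k := fun e => hp (e ▸ hk)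
    by_cases hl12 : l₁ = l₂
    · subst hl12
      have := G.eq_of_mem_lines hl h₁ hxy hx hy hx₁ hy₂
      subst this
      exact ⟨h, hh, l, hl, hp₁, hh₁, hz⟩
    have hhk : h ≠ k := by
      rintro rfl
      exact hl12 (G.eq_of_mem_lines h₁ h₂ hph hp₁ hh₁ hp₂ hk₂)
    have hl1 : l ≠ l₁ := by
      rintro rfl
      exact hl12 (G.eq_of_mem_lines h₁ h₂ hyp hy hp₁ hy₂ hp₂)
    have hl2 : l ≠ l₂ := by
      rintro rfl
      exact hl12 (G.eq_of_mem_lines h₁ h₂ hxp hx₁ hp₁ hx hp₂)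
    by_cases hzx : z = x
    · exact ⟨h, hh, l₁, h₁, hp₁, hh₁, hzx ▸ hx₁⟩
    by_cases hzy : z = y
    · exact ⟨k, hk, l₂, h₂, hp₂, hk₂, hzy ▸ hy₂⟩
    have hz1 : z ∉ l₁ := fun h => hl1 (G.eq_of_mem_lines hl h₁ hzx hz hx h hx₁)
    have hz2 : z ∉ l₂ := fun h => hl2 (G.eq_of_mem_lines hl h₂ hzy hz hy h hy₂)
    have hh2 : h ∉ l₂ := fun h' => hl12 (G.eq_of_mem_lines h₁ h₂ hph hp₁ hh₁ hp₂ h')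
    have hk1 : k ∉ l₁ := fun h' => hl12 (G.eq_of_mem_lines h₁ h₂ hpk hp₁ h' hp₂ hk₂)
    have hzh : z ≠ h := fun e => hz1 (e ▸ hh₁)
    obtain ⟨s, hs, hzs, hhs⟩ := G.exists_line hzh
    obtain ⟨t, ht, hpt, hzt⟩ := G.exists_line hzp.symm
    obtain ⟨u, hu, hhu, hku⟩ := G.exists_line hhk
    -- the lines `hz` and `py` meet
    obtain ⟨r, hrs, hr2⟩ := G.lines_meet h₁ hl hs h₂ hl1.symm hh₁ hp₁ hx₁ hz hy hx hxh.symm hxy.symm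
      hhs hzs hp₂ hy₂
    have hs2 : s ≠ l₂ := fun e => hh2 (e ▸ hhs)
    have hrz : r ≠ z := fun e => hz2 (e ▸ hr2)
    have hrh : r ≠ h := fun e => hh2 (e ▸ hr2)
    by_cases hrp : r = p
    · exfalso
      subst hrp
      exact hz1 (G.eq_of_mem_lines hs h₁ hph hrs hhs hp₁ hh₁ ▸ hzs)
    -- the lines `pz` and `kh` meet
    obtain ⟨w, hwt, hwu⟩ := G.lines_meet h₂ hs ht hu hs2.symm hp₂ hk₂ hr2 hzs hhs hrs
      (Ne.symm hrp) hrh.symm hpt hzt hku hhu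
    exact ⟨w, hH u hu h hhu k hku hhk hh hk hwu, t, ht, hpt, hwt, hzt⟩
  have norm : ∀ x ∈ H ∪ {x | x = p ∨ ∃ h ∈ H, ∃ l ∈ G.lines, p ∈ l ∧ h ∈ l ∧ x ∈ l}, x ≠ p →
      ∃ h ∈ H, ∃ l ∈ G.lines, p ∈ l ∧ h ∈ l ∧ x ∈ l := by
    rintro x (hx | hx | hx) hxp
    · obtain ⟨l, hl, h1, h2⟩ := G.exists_line hxp
      exact ⟨x, hx, l, hl, h2, h1, h1⟩
    · exact absurd hx hxp
    · exact hx
  intro l hl x hx y hy hxy hxT hyT z hz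
  by_cases hzp : z = p
  · exact Or.inr (Or.inl hzp)
  by_cases hxp : x = p
  · subst hxp
    obtain ⟨k, hk, m, hm, h1, h2, h3⟩ := norm y hyT hxy.symm
    exact Or.inr (Or.inr ⟨k, hk, m, hm, h1, h2, G.eq_of_mem_lines hl hm hxy hx hy h1 h3 ▸ hz⟩)
  by_cases hyp : y = p
  · subst hyp
    obtain ⟨k, hk, m, hm, h1, h2, h3⟩ := norm x hxT hxy
    exact Or.inr (Or.inr ⟨k, hk, m, hm, h1, h2, G.eq_of_mem_lines hl hm hxy hx hy h3 h1 ▸ hz⟩)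
  obtain ⟨h, hh, l₁, h₁, a1, a2, a3⟩ := norm x hxT hxp
  obtain ⟨k, hk, l₂, h₂, b1, b2, b3⟩ := norm y hyT hyp
  by_cases hxh : x = h
  · by_cases hyk : y = k
    · exact Or.inl (hH l hl x hx y hy hxy (hxh ▸ hh) (hyk ▸ hk) hz)
    · exact Or.inr (Or.inr (key y k x h z hk hh l₂ h₂ l₁ h₁ l hl b1 b2 b3 a1 a2 a3 hxy.symm
        hyp hxp hyk hy hx hz hzp))
  · exact Or.inr (Or.inr (key x h y k z hh hk l₁ h₁ l₂ h₂ l hl a1 a2 a3 b1 b2 b3 hxy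
      hxp hyp hxh hx hy hz hzp))

/-- If `p ∈ l` is not in `H`, the cone over `H` from `p` is a subspace larger than `H`, hence
everything. A second point of `l` outside `H` is therefore on a line from `p` to a point of `H`, and
that line is `l`. -/
theorem IsHyperplane.inter_line_nonempty {H : Set P} (hH : G.IsHyperplane H) {l : Set P}
    (hl : l ∈ G.lines) : (H ∩ l).Nonempty := by
  obtain ⟨p, hpl, -⟩ := G.three_points l hl
  obtain ⟨q, hql, hqp, -⟩ := G.exists_third_point hl p p
  by_cases hp : p ∈ H
  · exact ⟨p, hp, hpl⟩
  rcases hH.2.2 _ (hH.1.isSubspace_cone hp) Set.subset_union_left with h | h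
  · exact absurd (h ▸ Or.inr (Or.inl rfl)) hp
  · have : q ∈ H ∪ {x | x = p ∨ ∃ h ∈ H, ∃ l ∈ G.lines, p ∈ l ∧ h ∈ l ∧ x ∈ l} := h ▸ trivial
    rcases this with hq | hq | ⟨k, hk, m, hm, h1, h2, h3⟩
    · exact ⟨q, hq, hql⟩
    · exact absurd hq hqp
    · exact ⟨k, hk, G.eq_of_mem_lines hm hl hqp h3 h1 hql hpl ▸ h2⟩

theorem IsSubspace.inter {S T : Set P} (hS : G.IsSubspace S) (hT : G.IsSubspace T) :
    G.IsSubspace (S ∩ T) := fun l hl p hp q hq hpq hpS hqS =>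
  Set.subset_inter (hS l hl p hp q hq hpq hpS.1 hqS.1) (hT l hl p hp q hq hpq hpS.2 hqS.2)

theorem isSubspace_sInter {F : Set (Set P)} (hF : ∀ T ∈ F, G.IsSubspace T) :
    G.IsSubspace (⋂₀ F) := fun l hl p hp q hq hpq hpS hqS =>
  Set.subset_sInter fun T hT => hF T hT l hl p hp q hq hpq (hpS T hT) (hqS T hT)

/-- The exchange property of hyperplanes. -/
theorem IsHyperplane.exchange {T H K : Set P} (hT : G.IsSubspace T) (hH : G.IsHyperplane H)
    (hK : G.IsSubspace K) (h : T ∩ H ⊆ K) (hTK : ¬ T ⊆ K) : T ∩ K ⊆ H := by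
  rintro x ⟨hxT, hxK⟩
  by_contra hxH
  obtain ⟨y, hyT, hyK⟩ := Set.not_subset.1 hTK
  have hxy : x ≠ y := fun e => hyK (e ▸ hxK)
  obtain ⟨l, hl, hxl, hyl⟩ := G.exists_line hxy
  obtain ⟨z, hzH, hzl⟩ := hH.inter_line_nonempty hl
  have hzK : z ∈ K := h ⟨hT l hl x hxl y hyl hxy hxT hyT hzl, hzH⟩
  exact hyK (hK l hl x hxl z hzl (fun e => hxH (e ▸ hzH)) hxK hzK hyl)

theorem IsHyperplane.eq_of_subset {H K : Set P} (hH : G.IsHyperplane H) (hK : G.IsHyperplane K)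
    (h : H ⊆ K) : H = K :=
  ((hH.2.2 K hK.1 h).resolve_right hK.2.1).symm

/-- A subspace is determined by its part off a subspace that does not contain it. -/
theorem IsSubspace.subset_of_diff_subset {T I K : Set P} (hT : G.IsSubspace T)
    (hI : G.IsSubspace I) (hK : G.IsSubspace K) (hTI : ¬ T ⊆ I) (h : T \ I ⊆ K) : T ⊆ K := by
  intro p hp
  by_cases hpI : p ∈ I
  · obtain ⟨a, haT, haI⟩ := Set.not_subset.1 hTI
    have hpa : p ≠ a := fun e => haI (e ▸ hpI)
    obtain ⟨l, hl, hpl, hal⟩ := G.exists_line hpa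
    -- A third point of the line `pa` is also outside `I`, so `p` is on a line through two points of
    -- `T \ I`.
    obtain ⟨r, hrl, hrp, hra⟩ := G.exists_third_point hl p a
    have hrT := hT l hl p hpl a hal hpa hp haT hrl
    have hrI : r ∉ I := fun hr => haI (hI l hl p hpl r hrl hrp.symm hpI hr hal)
    exact hK l hl r hrl a hal hra (h ⟨hrT, hrI⟩) (h ⟨haT, haI⟩) hpl
  · exact h ⟨hp, hpI⟩

theorem isSubspace_span (S : Set P) : G.IsSubspace (G.span S) :=
  isSubspace_sInter fun _ hT => hT.1

theorem subset_span (S : Set P) : S ⊆ G.span S := Set.subset_sInter fun _ hT => hT.2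

/-- This makes the projective closure of an affine hyperplane the projective hyperplane it came
from. -/
theorem IsHyperplane.span_diff {H I : Set P} (hH : G.IsHyperplane H) (hI : G.IsHyperplane I)
    (h : H ≠ I) : G.span (H \ I) = H := by
  have hle : G.span (H \ I) ⊆ H := fun _ hx => hx H ⟨hH.1, Set.sdiff_subset⟩
  refine hle.antisymm ?_
  exact hH.1.subset_of_diff_subset hI.1 (isSubspace_span _)
    (fun hs => h (hH.eq_of_subset hI hs)) (subset_span _)

end ProjectiveGeometry

/-! ### Paths, circles and closure in the graphic matroid -/

namespace Graph

variable {N E B : Type*} {Γ : Graph N E}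

/-- Indexing by `ℕ` lets paths be cut, reversed and joined by plain arithmetic on indices. -/
theorem IsPathFromTo.exists_nat {x y : N} {W : Set N} {S : Set E} (h : Γ.IsPathFromTo x y W S)
    (hxy : x ≠ y) : ∃ (n : ℕ) (v : ℕ → N) (e : ℕ → E), 0 < n ∧ Set.InjOn v (Set.Iic n) ∧
      v 0 = x ∧ v n = y ∧ (∀ i < n, Γ.IsLink (e i) (v i) (v (i + 1))) ∧
      W = v '' Set.Iic n ∧ S = e '' Set.Iio n := by
  obtain ⟨n, v, e, hv, h0, hn, -, hl, hW, hS⟩ := h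
  rcases n with _ | n
  · exact absurd (h0.symm.trans hn) hxy
  -- The values out of range are arbitrary; `e 0` exists because distinct endpoints force positive
  -- length.
  refine ⟨n + 1, fun i => if h : i < n + 2 then v ⟨i, h⟩ else x,
    fun i => if h : i < n + 1 then e ⟨i, h⟩ else e 0, n.succ_pos, ?_, ?_, ?_, ?_, ?_, ?_⟩
  · intro i hi j hj hij
    have hi' : i < n + 2 := Nat.lt_succ_of_le hi
    have hj' : j < n + 2 := Nat.lt_succ_of_le hj
    simp only [hi', hj', dif_pos] at hij
    simpa using hv hij
  · simpa using h0
  · simpa [Fin.last] using hn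
  · intro i hi
    have h1 : i < n + 2 := by omega
    have h2 : i + 1 < n + 2 := by omega
    simp only [hi, h1, h2, dif_pos]
    exact hl ⟨i, hi⟩
  · rw [hW]
    ext z
    constructor
    · rintro ⟨i, rfl⟩
      exact ⟨i, Nat.le_of_lt_succ i.2, by simp⟩
    · rintro ⟨i, hi, rfl⟩
      have hi' : i < n + 2 := Nat.lt_succ_of_le hi
      exact ⟨⟨i, hi'⟩, by simp [hi']⟩
  · rw [hS]
    ext z
    constructor
    · rintro ⟨i, rfl⟩
      exact ⟨i, i.2, by simp only [i.2, dif_pos]⟩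
    · rintro ⟨i, hi, rfl⟩
      have hi' : i < n + 1 := hi
      exact ⟨⟨i, hi'⟩, by simp [hi']⟩

theorem isCircle_of_nat {k : ℕ} (hk : 0 < k) {v : ℕ → N} {e : ℕ → E}
    (hv : Set.InjOn v (Set.Iio k)) (he : Set.InjOn e (Set.Iio k))
    (hl : ∀ i < k, Γ.IsLink (e i) (v i) (v (i + 1))) (h0 : v k = v 0) :
    Γ.IsCircle (e '' Set.Iio k) := by
  obtain ⟨n, rfl⟩ : ∃ n, k = n + 1 := ⟨k - 1, by omega⟩
  have hstep : ∀ i : Fin (n + 1), Γ.IsLink (e i.val) (v i.val) (v (i + 1).val) := by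
    intro i
    rw [Fin.val_add_one]
    split_ifs with h
    · have := hl i.val i.2
      rw [h, Fin.val_last] at this ⊢
      rwa [← h0]
    · exact hl i.val i.2
  refine ⟨n, fun i : Fin (n + 1) => v i.val, fun i : Fin (n + 1) => e i.val, ?_, ?_, ?_, ?_⟩
  · intro (i : Fin (n + 1)) (j : Fin (n + 1)) hij
    exact Fin.ext (hv i.2 j.2 hij)
  · intro (i : Fin (n + 1)) (j : Fin (n + 1)) hij
    exact Fin.ext (he i.2 j.2 hij)
  · exact hstep
  · ext z
    constructor
    · rintro ⟨i, hi, rfl⟩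
      exact ⟨(⟨i, hi⟩ : Fin (n + 1)), rfl⟩
    · rintro ⟨i, rfl⟩
      exact ⟨_, (show Fin (n + 1) from i).2, rfl⟩

theorem injOn_edges_of_nat_path {n : ℕ} {v : ℕ → N} {e : ℕ → E} (hv : Set.InjOn v (Set.Iic n))
    (hl : ∀ i < n, Γ.IsLink (e i) (v i) (v (i + 1))) : Set.InjOn e (Set.Iio n) := by
  intro i hi j hj hij
  have hi : i < n := hi
  have hj : j < n := hj
  have h1 := hl i hi
  rw [hij] at h1
  rcases h1.eq_and_eq_or_eq_and_eq (hl j hj) with ⟨h, -⟩ | ⟨h, h'⟩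
  · exact hv hi.le hj.le h
  · have a := hv (show i ∈ Set.Iic n from hi.le) (show j + 1 ∈ Set.Iic n from hj) h
    have b := hv (show i + 1 ∈ Set.Iic n from hi) (show j ∈ Set.Iic n from hj.le) h'
    omega

/-- Two internally disjoint paths with the same endpoints form a circle. -/
theorem IsPathFromTo.isCircle_union {x y : N} {U V : Set N} {P Q : Set E}
    (hP : Γ.IsPathFromTo x y U P) (hQ : Γ.IsPathFromTo x y V Q) (hxy : x ≠ y)
    (hUV : U ∩ V ⊆ {x, y}) (hPQ : Disjoint P Q) : Γ.IsCircle (P ∪ Q) := by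
  obtain ⟨n, v, e, hn, hv, hv0, hvn, hl, rfl, rfl⟩ := hP.exists_nat hxy
  obtain ⟨m, w, f, hm, hw, hw0, hwm, hl', rfl, rfl⟩ := hQ.exists_nat hxy
  have he := injOn_edges_of_nat_path hv hl
  have hf := injOn_edges_of_nat_path hw hl'
  have hcross : ∀ i ≤ n, ∀ j, 0 < j → j < m → v i ≠ w j := by
    intro i hi j hj0 hjm hij
    have : v i ∈ ({x, y} : Set N) := hUV ⟨⟨i, hi, rfl⟩, ⟨j, hjm.le, hij.symm⟩⟩
    rw [hij] at this
    rcases this with h | h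
    · rw [← hw0] at h
      have := hw (show j ∈ Set.Iic m from hjm.le) (Set.mem_Iic.2 m.zero_le) h
      omega
    · have h : w j = y := h
      rw [← hwm] at h
      have := hw (show j ∈ Set.Iic m from hjm.le) (Set.mem_Iic.2 le_rfl) h
      omega
  have hcross' : ∀ i < n, ∀ j < m, e i ≠ f j := fun i hi j hj hij =>
    Set.disjoint_left.1 hPQ ⟨i, hi, rfl⟩ ⟨j, hj, hij.symm⟩
  -- The circle follows the first path forward, then the second one backward. Its `i`-th edge joins
  -- `w (n + m - i)` to `w (n + m - i - 1)`, hence the index `n + m - 1 - i`.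
  have := isCircle_of_nat (Γ := Γ) (k := n + m) (by omega)
    (v := fun i => if i ≤ n then v i else w (n + m - i))
    (e := fun i => if i < n then e i else f (n + m - 1 - i)) ?_ ?_ ?_ ?_
  · convert this using 1
    ext z
    constructor
    · rintro (⟨i, hi, rfl⟩ | ⟨i, hi, rfl⟩)
      · have hi : i < n := hi
        exact ⟨i, Set.mem_Iio.2 (by omega), by simp [hi]⟩
      · have hi : i < m := hi
        refine ⟨n + m - 1 - i, Set.mem_Iio.2 (by omega), ?_⟩
        have : ¬ n + m - 1 - i < n := by omega
        simp only [this, if_false]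
        congr 1
        omega
    · rintro ⟨i, hi, rfl⟩
      have hi : i < n + m := hi
      by_cases h : i < n
      · exact Or.inl ⟨i, h, by simp [h]⟩
      · exact Or.inr ⟨n + m - 1 - i, Set.mem_Iio.2 (by omega), by simp [h]⟩
  · intro i hi j hj hij
    have hi : i < n + m := hi
    have hj : j < n + m := hj
    dsimp only at hij
    split_ifs at hij with h1 h2 h2
    · exact hv h1 h2 hij
    · exact absurd hij (hcross i h1 _ (by omega) (by omega))
    · exact absurd hij.symm (hcross j h2 _ (by omega) (by omega))
    · have := hw (Set.mem_Iic.2 (by omega)) (Set.mem_Iic.2 (by omega)) hij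
      omega
  · intro i hi j hj hij
    have hi : i < n + m := hi
    have hj : j < n + m := hj
    dsimp only at hij
    split_ifs at hij with h1 h2 h2
    · exact he h1 h2 hij
    · exact absurd hij (hcross' i h1 _ (by omega))
    · exact absurd hij.symm (hcross' j h2 _ (by omega))
    · have := hf (Set.mem_Iio.2 (by omega)) (Set.mem_Iio.2 (by omega)) hij
      omega
  · intro i hi
    by_cases h : i < n
    · have h1 : i ≤ n := h.le
      have h2 : i + 1 ≤ n := h
      simp only [h, h1, h2, if_true]
      exact hl i h
    · have h2 : ¬ i + 1 ≤ n := by omega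
      have hlink := hl' (n + m - 1 - i) (by omega)
      have e1 : n + m - (i + 1) = n + m - 1 - i := by omega
      have e2 : n + m - 1 - i + 1 = n + m - i := by omega
      rw [e2] at hlink
      simp only [h, h2, if_false, e1]
      split_ifs with h3
      · have : i = n := by omega
        subst this
        rw [hvn, ← hwm]
        simpa using hlink.symm
      · exact hlink.symm
  · have h1 : ¬ n + m ≤ n := by omega
    simp [h1, hw0, hv0]

theorem isPathFromTo_single {e : E} {x y : N} (h : Γ.IsLink e x y) (hxy : x ≠ y) :
    Γ.IsPathFromTo x y {x, y} {e} := by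
  refine ⟨1, ![x, y], ![e], ?_, rfl, rfl, ?_, ?_, ?_, ?_⟩
  · intro i j
    fin_cases i <;> fin_cases j <;> simp [hxy, hxy.symm]
  · intro i
    fin_cases i
    · exact h.left_mem
    · exact h.right_mem
  · intro i
    fin_cases i
    exact h
  · simp [Matrix.range_cons, Set.pair_comm]
  · simp [Matrix.range_cons]

theorem IsPathFromTo.isCircle_insert {x y : N} {W : Set N} {Q : Set E} {e : E}
    (hQ : Γ.IsPathFromTo x y W Q) (h : Γ.IsLink e x y) (hxy : x ≠ y) (he : e ∉ Q) :
    Γ.IsCircle (insert e Q) :=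
  (isPathFromTo_single h hxy).isCircle_union hQ hxy Set.inter_subset_left
    (Set.disjoint_singleton_left.2 he)

/-- Removal of an edge from a circle leaves a path. -/
theorem IsCircle.mem_clos {C : Set E} (hC : Γ.IsCircle C) {e : E} (he : e ∈ C) :
    e ∈ Γ.clos (C \ {e}) := by
  obtain ⟨n, v, f, hv, hf, hl, rfl⟩ := hC
  obtain ⟨j, rfl⟩ := he
  change Fin (n + 1) → N at v
  change Fin (n + 1) → E at f
  change Fin (n + 1) at j
  change Function.Injective v at hv
  change Function.Injective f at hf
  change ∀ i : Fin (n + 1), Γ.IsLink (f i) (v i) (v (i + 1)) at hl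
  -- Start just after the removed edge and go once around; indices are cyclic, since `ZMod (n + 1)`
  -- is `Fin (n + 1)`.
  refine Or.inr ⟨v (j + 1), v j, _, _, (hl j).symm, ⟨n, fun i => v (j + 1 + i),
    fun i => f (j + 1 + i.castSucc), ?_, ?_, ?_, ?_, ?_, rfl, rfl⟩, ?_⟩
  · exact hv.comp (add_right_injective _)
  · simp
  · have : j + 1 + Fin.last n = j := by
      rw [add_assoc, add_comm 1, Fin.last_add_one, add_zero]
    dsimp only
    rw [this]
  · exact fun i => (hl _).left_mem
  · intro i
    have := hl (j + 1 + i.castSucc)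
    rwa [add_assoc (j + 1), Fin.coeSucc_eq_succ] at this
  · rintro _ ⟨i, rfl⟩
    refine ⟨⟨_, rfl⟩, fun h => ?_⟩
    have h : j + 1 + i.castSucc = j := hf h
    have h1 : j + 1 + Fin.last n = j := by
      rw [add_assoc, add_comm 1, Fin.last_add_one, add_zero]
    exact i.castSucc_lt_last.ne (add_left_cancel (h.trans h1.symm))

theorem IsCircle.finite {C : Set E} (hC : Γ.IsCircle C) : C.Finite := by
  obtain ⟨n, v, f, -, -, -, rfl⟩ := hC
  exact Set.finite_range f

theorem IsPathFromTo.finite {x y : N} {W : Set N} {Q : Set E} (hQ : Γ.IsPathFromTo x y W Q) :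
    Q.Finite := by
  obtain ⟨n, v, f, -, -, -, -, -, -, rfl⟩ := hQ
  exact Set.finite_range f

theorem IsPathFromTo.subset_edgeSet {x y : N} {W : Set N} {Q : Set E}
    (hQ : Γ.IsPathFromTo x y W Q) : Q ⊆ Γ.edgeSet := by
  obtain ⟨n, v, f, -, -, -, -, hl, -, rfl⟩ := hQ
  rintro _ ⟨i, rfl⟩
  exact (hl i).edge_mem

/-- A path contains no circle. -/
theorem IsPathFromTo.isForest {x y : N} {W : Set N} {Q : Set E}
    (hQ : Γ.IsPathFromTo x y W Q) (hxy : x ≠ y) : Γ.IsForest Q := by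
  refine ⟨hQ.subset_edgeSet, fun C hCQ hC => ?_⟩
  obtain ⟨n, p, e, -, hp, -, -, hl, -, rfl⟩ := hQ.exists_nat hxy
  obtain ⟨k, v, f, hv, hf, hl', rfl⟩ := hC
  choose j hj hfj using fun i => hCQ (Set.mem_range_self i)
  -- Among the edges of the circle take the one farthest along the path. No other edge of the circle
  -- meets its far end, so the next or previous edge of the circle is the same edge, which would be
  -- a loop.
  obtain ⟨i₀, hi₀⟩ := Finite.exists_max (α := ZMod (k + 1)) j
  have key : ∀ i z, Γ.IsLink (f i) (p (j i₀ + 1)) z → i = i₀ := by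
    intro i z h
    have hji : j i < n := hj i
    have hji₀ : j i₀ < n := hj i₀
    rw [← hfj i] at h
    have : j i₀ = j i := by
      have := hi₀ i
      rcases h.left_eq_or_eq (hl _ hji) with h | h
      · have := hp (Set.mem_Iic.2 hji₀) (Set.mem_Iic.2 hji.le) h
        omega
      · have := hp (Set.mem_Iic.2 hji₀) (Set.mem_Iic.2 hji) h
        omega
    exact hf (by rw [← hfj i, ← hfj i₀, this])
  have hlink := hl _ (hj i₀)
  rw [hfj i₀] at hlink
  have hne : p (j i₀ + 1) ≠ p (j i₀) := by
    intro h
    have := hp (Set.mem_Iic.2 (hj i₀)) (Set.mem_Iic.2 (le_of_lt (hj i₀))) h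
    omega
  have hloop : ∀ z, ¬ Γ.IsLink (f i₀) z z := by
    intro z hz
    rcases hlink.eq_and_eq_or_eq_and_eq hz with ⟨a, b⟩ | ⟨a, b⟩ <;> exact hne (b.trans a.symm)
  rcases hlink.right_eq_or_eq (hl' i₀) with h | h
  · have h1 := hl' (i₀ - 1)
    rw [sub_add_cancel, ← h] at h1
    have h2 := key _ _ h1.symm
    have h3 := hl' (i₀ - 1)
    rw [sub_add_cancel, h2] at h3
    exact hloop _ h3
  · have h1 := hl' (i₀ + 1)
    rw [← h] at h1
    have h2 := key _ _ h1
    have h3 := hl' i₀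
    rw [h2] at h3
    exact hloop _ h3

theorem IsPathFromTo.left_mem {x y : N} {W : Set N} {Q : Set E}
    (hQ : Γ.IsPathFromTo x y W Q) {e : E} (he : e ∈ Q) {a b : N} (h : Γ.IsLink e a b) : a ∈ W := by
  obtain ⟨n, v, f, -, -, -, -, hl, rfl, rfl⟩ := hQ
  obtain ⟨i, rfl⟩ := he
  rcases h.left_eq_or_eq (hl i) with h | h <;> exact ⟨_, h.symm⟩

theorem clos_mono {S T : Set E} (h : S ⊆ T) : Γ.clos S ⊆ Γ.clos T := by
  rintro e (he | ⟨x, y, W, Q, h1, h2, h3⟩)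
  · exact Or.inl (h he)
  · exact Or.inr ⟨x, y, W, Q, h1, h2, h3.trans h⟩

theorem exists_finite_of_mem_clos {S : Set E} {e : E} (h : e ∈ Γ.clos S) :
    ∃ F ⊆ S, F.Finite ∧ e ∈ Γ.clos F := by
  rcases h with he | ⟨x, y, W, Q, h1, h2, h3⟩
  · exact ⟨{e}, Set.singleton_subset_iff.2 he, Set.finite_singleton e, Or.inl rfl⟩
  · exact ⟨Q, h3, h2.finite, Or.inr ⟨x, y, W, Q, h1, h2, subset_rfl⟩⟩

/-- A path in `X` between the ends of `r` would have an edge at `b`. -/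
theorem notMem_clos_of_forall_not_isLink {X : Set E} {r : E} {a b : N} (h : Γ.IsLink r a b)
    (hab : a ≠ b) (hX : ∀ e ∈ X, ∀ z, ¬ Γ.IsLink e b z) : r ∉ Γ.clos X := by
  rintro (hr | ⟨x, y, W, Q, h1, h2, h3⟩)
  · exact hX r hr a h.symm
  · have hb := h.right_eq_or_eq h1
    have hxy : x ≠ y := by
      rintro rfl
      rcases h1.eq_and_eq_or_eq_and_eq h with ⟨h, h'⟩ | ⟨h, h'⟩
      · exact hab (h.symm.trans h')
      · exact hab (h'.symm.trans h)
    obtain ⟨n, v, e, hn, -, hv0, hvn, hl, -, rfl⟩ := h2.exists_nat hxy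
    rcases hb with rfl | rfl
    · exact hX _ (h3 ⟨0, hn, rfl⟩) _ (hv0 ▸ hl 0 hn)
    · have := hl (n - 1) (by omega)
      rw [Nat.sub_add_cancel hn, hvn] at this
      exact hX _ (h3 ⟨n - 1, Set.mem_Iio.2 (by omega), rfl⟩) _ this.symm

theorem exists_isCircle_of_mem_clos (hΓ : ∀ e x, ¬ Γ.IsLink e x x) {S : Set E} {e : E}
    (h : e ∈ Γ.clos S) (he : e ∉ S) : ∃ C, Γ.IsCircle C ∧ e ∈ C ∧ C ⊆ S ∪ {e} := by
  rcases h with h | ⟨x, y, W, Q, h1, h2, h3⟩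
  · exact absurd h he
  · have hxy : x ≠ y := by
      rintro rfl
      exact hΓ _ _ h1
    refine ⟨_, h2.isCircle_insert h1 hxy fun h => he (h3 h), Set.mem_insert _ _, ?_⟩
    rintro z (rfl | hz)
    · exact Or.inr rfl
    · exact Or.inl (h3 hz)

theorem mem_clos_pullback {Δ : Graph N B} {p : E → B} (hΔ : ∀ b x, ¬ Δ.IsLink b x x) {S : Set E}
    {e : E} (he : p e ∈ Δ.edgeSet) :
    e ∈ (Δ.pullback p).clos S ↔ p e ∈ Δ.clos (p '' S) := by
  constructor
  · rintro (h | ⟨x, y, W, Q, h1, ⟨n, v, f, hv, h0, hn, hV, hl, hW, rfl⟩, h3⟩)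
    · exact Or.inl ⟨e, h, rfl⟩
    · refine Or.inr ⟨x, y, W, p '' Set.range f, h1, ⟨n, v, p ∘ f, hv, h0, hn, hV, hl, hW,
        (Set.range_comp p f).symm⟩, Set.image_mono h3⟩
  · rintro (⟨f, hf, hfe⟩ | ⟨x, y, W, Q, h1, ⟨n, v, f, hv, h0, hn, hV, hl, hW, rfl⟩, h3⟩)
    -- An edge of `S` parallel to `e` is itself a path between the ends of `e`.
    · obtain ⟨x, y, hxy⟩ := Δ.exists_isLink_of_mem_edgeSet he
      have hne : x ≠ y := by
        rintro rfl
        exact hΔ _ _ hxy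
      have hlink : (Δ.pullback p).IsLink f x y := show Δ.IsLink (p f) x y from hfe ▸ hxy
      exact Or.inr ⟨x, y, _, _, hxy, isPathFromTo_single hlink hne, Set.singleton_subset_iff.2 hf⟩
    · choose g hg hgf using fun i => h3 (Set.mem_range_self i)
      refine Or.inr ⟨x, y, W, Set.range g, h1, ⟨n, v, g, hv, h0, hn, hV, fun i => ?_, hW, rfl⟩, ?_⟩
      · change Δ.IsLink (p (g i)) _ _
        rw [hgf]
        exact hl i
      · rintro _ ⟨i, rfl⟩
        exact hg i

end Graph

/-! ### The closure operator of the projectivized arrangement -/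

namespace HyperplaneArrangement

open ProjectiveGeometry

variable {P E N B : Type*} {A : AffineGeometry P} (𝒜 : HyperplaneArrangement A E)

theorem exists_hyperplane (e : E) : A.IsHyperplane (𝒜.hP (some e)) ∧ 𝒜.hP (some e) ≠ A.hInf ∧
    𝒜.h e = 𝒜.hP (some e) \ A.hInf := by
  obtain ⟨H, hH, hne, he⟩ := 𝒜.isAffineHyperplane e
  have : 𝒜.hP (some e) = H := by
    change A.span (𝒜.h e) = H
    rw [he, hH.span_diff A.isHyperplane_hInf hne]
  rw [this]
  exact ⟨hH, hne, he⟩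

theorem isHyperplane_hP : ∀ x, A.IsHyperplane (𝒜.hP x)
  | none => A.isHyperplane_hInf
  | some e => (𝒜.exists_hyperplane e).1

theorem hP_injective : Function.Injective 𝒜.hP := by
  rintro (_ | e) (_ | f) h
  · rfl
  · exact absurd h.symm (𝒜.exists_hyperplane f).2.1
  · exact absurd h (𝒜.exists_hyperplane e).2.1
  · refine congrArg some (𝒜.injective ?_)
    rw [(𝒜.exists_hyperplane e).2.2, (𝒜.exists_hyperplane f).2.2, h]

theorem eq_of_hP_subset {x y : Option E} (h : 𝒜.hP x ⊆ 𝒜.hP y) : x = y :=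
  𝒜.hP_injective ((𝒜.isHyperplane_hP x).eq_of_subset (𝒜.isHyperplane_hP y) h)

theorem tP_anti {S T : Set (Option E)} (h : S ⊆ T) : 𝒜.tP T ⊆ 𝒜.tP S :=
  Set.biInter_subset_biInter_left h

theorem tP_subset_hP {S : Set (Option E)} {x : Option E} (h : x ∈ S) : 𝒜.tP S ⊆ 𝒜.hP x :=
  Set.biInter_subset_of_mem h

theorem tP_insert (x : Option E) (S : Set (Option E)) : 𝒜.tP (insert x S) = 𝒜.hP x ∩ 𝒜.tP S :=
  Set.biInter_insert _ _ _

theorem isSubspace_tP (S : Set (Option E)) : A.IsSubspace (𝒜.tP S) := by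
  rw [tP, ← Set.sInter_image]
  refine isSubspace_sInter ?_
  rintro _ ⟨x, -, rfl⟩
  exact (𝒜.isHyperplane_hP x).1

theorem tP_exchange {S : Set (Option E)} {x y : Option E} (hy : ¬ 𝒜.tP S ⊆ 𝒜.hP y)
    (h : 𝒜.tP (insert x S) ⊆ 𝒜.hP y) : 𝒜.tP (insert y S) ⊆ 𝒜.hP x := by
  rw [tP_insert, Set.inter_comm] at h ⊢
  exact (𝒜.isHyperplane_hP x).exchange (𝒜.isSubspace_tP S) (𝒜.isHyperplane_hP y).1 h hy

theorem tA_eq (S : Set E) : 𝒜.tA S = 𝒜.tP (some '' S) \ A.hInf := by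
  ext p
  simp only [tA, tP, Set.mem_inter_iff, Set.mem_compl_iff, Set.mem_iInter, Set.mem_sdiff,
    Set.forall_mem_image]
  constructor
  · rintro ⟨h1, h2⟩
    refine ⟨fun e he => ?_, h1⟩
    have := h2 e he
    rw [(𝒜.exists_hyperplane e).2.2] at this
    exact this.1
  · rintro ⟨h1, h2⟩
    refine ⟨h2, fun e he => ?_⟩
    rw [(𝒜.exists_hyperplane e).2.2]
    exact ⟨h1 he, h2⟩

theorem tA_nonempty_iff (S : Set E) : (𝒜.tA S).Nonempty ↔ ¬ 𝒜.tP (some '' S) ⊆ 𝒜.hP none := by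
  rw [tA_eq, Set.sdiff_nonempty]
  rfl

/-- A subspace not contained in `hInf` is determined by its affine part, so affine containments can
be tested projectively. -/
theorem tA_subset_h_iff {S : Set E} (hS : (𝒜.tA S).Nonempty) (e : E) :
    𝒜.tA S ⊆ 𝒜.h e ↔ 𝒜.tP (some '' S) ⊆ 𝒜.hP (some e) := by
  rw [tA_nonempty_iff] at hS
  rw [tA_eq, (𝒜.exists_hyperplane e).2.2]
  constructor
  · intro h
    exact (𝒜.isSubspace_tP _).subset_of_diff_subset A.isHyperplane_hInf.1
      (𝒜.isHyperplane_hP _).1 hS (h.trans Set.sdiff_subset)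
  · exact fun h => Set.sdiff_subset_sdiff_left h

theorem tP_ideal_subset_iff (S : Set E) (e : E) :
    𝒜.tP (insert none (some '' S)) ⊆ 𝒜.hP (some e) ↔
      A.hInf ∩ ⋂₀ (𝒜.ideal '' S) ⊆ 𝒜.ideal e := by
  have : 𝒜.tP (insert none (some '' S)) = A.hInf ∩ ⋂₀ (𝒜.ideal '' S) := by
    rw [tP_insert]
    ext p
    simp only [tP, hP, ideal, Set.mem_inter_iff, Set.mem_iInter, Set.mem_sInter,
      Set.forall_mem_image]
    exact ⟨fun h => ⟨h.1, fun e he => ⟨h.2 he, h.1⟩⟩, fun h => ⟨h.1, fun e he => (h.2 he).1⟩⟩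
  rw [this]
  exact ⟨fun h => Set.subset_inter h Set.inter_subset_left, fun h => h.trans Set.inter_subset_left⟩

/-! ### Ideal parts and the graphic matroid -/

variable {𝒜}

theorem ideal_exchange {G : Set (Set P)} (hG : G ⊆ 𝒜.idealFamily) {a b : Set P}
    (ha : a ∈ 𝒜.idealFamily) (hb : b ∈ 𝒜.idealFamily) (hGb : ¬ A.hInf ∩ ⋂₀ G ⊆ b)
    (h : A.hInf ∩ ⋂₀ (insert a G) ⊆ b) : A.hInf ∩ ⋂₀ (insert b G) ⊆ a := by
  have hsub : ∀ c ∈ 𝒜.idealFamily, A.IsSubspace c := by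
    rintro _ ⟨e, rfl⟩
    exact (𝒜.isHyperplane_hP _).1.inter A.isHyperplane_hInf.1
  have hT : A.IsSubspace (A.hInf ∩ ⋂₀ G) :=
    A.isHyperplane_hInf.1.inter (isSubspace_sInter fun c hc => hsub c (hG hc))
  obtain ⟨e, rfl⟩ := ha
  rw [Set.sInter_insert] at h ⊢
  have := (𝒜.isHyperplane_hP (some e)).exchange hT (hsub b hb)
    (fun p hp => h ⟨hp.1.1, ⟨hp.2, hp.1.1⟩, hp.1.2⟩) hGb
  exact fun p hp => ⟨this ⟨⟨hp.1, hp.2.2⟩, hp.2.1⟩, hp.1⟩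

variable {Δ : Graph N B} {ε : Set P → B}

/-- The closure operator of the matroid of ideal parts corresponds to that of the graphic
matroid. -/
theorem IsGraphicVia.subset_iff_mem_clos (hε : 𝒜.IsGraphicVia Δ ε)
    (hΔ : ∀ b x, ¬ Δ.IsLink b x x) {F : Set (Set P)} (hF : F ⊆ 𝒜.idealFamily) (hfin : F.Finite)
    {a : Set P} (ha : a ∈ 𝒜.idealFamily) :
    A.hInf ∩ ⋂₀ F ⊆ a ↔ ε a ∈ Δ.clos (ε '' F) := by
  have anti : ∀ {X Y : Set (Set P)}, X ⊆ Y → A.hInf ∩ ⋂₀ Y ⊆ A.hInf ∩ ⋂₀ X := fun h =>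
    Set.inter_subset_inter_right _ (Set.sInter_subset_sInter h)
  have mem : ∀ {X : Set (Set P)} {c}, c ∈ X → A.hInf ∩ ⋂₀ X ⊆ c := fun h =>
    Set.inter_subset_right.trans (Set.sInter_subset_of_mem h)
  by_cases haF : a ∈ F
  · exact ⟨fun _ => Or.inl ⟨a, haF, rfl⟩, fun _ => mem haF⟩
  constructor
  · intro h
    -- For a minimal `G` whose intersection lies in `a`, the set `G ∪ {a}` is dependent and so
    -- carries a circle. The circle passes through `ε a`: otherwise `G` is dependent and some member
    -- could be dropped.
    have hs : {G | G ⊆ F ∧ A.hInf ∩ ⋂₀ G ⊆ a}.Finite := hfin.finite_subsets.subset fun G hG => hG.1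
    obtain ⟨G, hGF, hG⟩ := hs.exists_le_minimal (a := F) ⟨subset_rfl, h⟩
    obtain ⟨⟨-, hGa⟩, hmin⟩ := hG
    have hGF : G ⊆ F := hGF
    have hGI := hGF.trans hF
    have haG : a ∉ G := fun h => haF (hGF h)
    have hGfin := hfin.subset hGF
    have hdep : ¬ Δ.IsForest (ε '' insert a G) := by
      rw [← hε.2 _ (Set.insert_subset ha hGI)]
      intro hind
      refine hind _ subset_rfl (hGfin.insert a) a (Set.mem_insert _ _) ?_
      rwa [Set.insert_sdiff_self_of_notMem haG]
    have hedge : ε '' insert a G ⊆ Δ.edgeSet := by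
      rintro _ ⟨c, hc, rfl⟩
      exact hε.1.mapsTo (Set.insert_subset ha hGI hc)
    simp only [Graph.IsForest, hedge, true_and, not_forall, not_not] at hdep
    obtain ⟨C, hCG, hC⟩ := hdep
    by_cases haC : ε a ∈ C
    · refine Graph.clos_mono ?_ (hC.mem_clos haC)
      rintro c ⟨hc, hca⟩
      obtain ⟨d, rfl | hd, rfl⟩ := hCG hc
      · exact absurd rfl hca
      · exact ⟨d, hGF hd, rfl⟩
    · exfalso
      have hCG' : C ⊆ ε '' G := by
        intro c hc
        obtain ⟨d, rfl | hd, rfl⟩ := hCG hc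
        · exact absurd hc haC
        · exact ⟨d, hd, rfl⟩
      have hnf : ¬ Δ.IsForest (ε '' G) := fun hf => hf.2 C hCG' hC
      rw [← hε.2 _ hGI] at hnf
      simp only [IndepHyperplanes, not_forall, not_not] at hnf
      obtain ⟨G₀, hG₀, -, b, hb, hsub⟩ := hnf
      have hb' : A.hInf ∩ ⋂₀ (G \ {b}) ⊆ b := (anti (Set.sdiff_subset_sdiff_left hG₀)).trans hsub
      have hGb : G ⊆ G \ {b} := hmin ⟨Set.sdiff_subset.trans hGF, fun p hp => hGa ⟨hp.1, by
        intro c hc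
        by_cases hcb : c = b
        · exact hcb ▸ hb' hp
        · exact hp.2 c ⟨hc, hcb⟩⟩⟩ Set.sdiff_subset
      exact (hGb (hG₀ hb)).2 rfl
  · intro h
    rcases h with ⟨c, hc, hca⟩ | ⟨x, y, W, Q, hl, hQ, hQF⟩
    · rw [hε.1.injOn (hF hc) ha hca] at hc
      exact absurd hc haF
    have hxy : x ≠ y := by
      rintro rfl
      exact hΔ _ _ hl
    obtain ⟨G, hGF, rfl⟩ : ∃ G ⊆ F, ε '' G = Q := Set.subset_image_iff.1 hQF
    have hGI := hGF.trans hF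
    have haG : a ∉ G := fun h => haF (hGF h)
    have haQ : ε a ∉ ε '' G := by
      rintro ⟨c, hc, hca⟩
      exact haG (hε.1.injOn (hGI hc) ha hca ▸ hc)
    have hdep : ¬ IndepHyperplanes A.hInf (insert a G) := by
      rw [hε.2 _ (Set.insert_subset ha hGI), Set.image_insert_eq]
      exact fun hf => hf.2 _ subset_rfl (hQ.isCircle_insert hl hxy haQ)
    -- The path is independent, but becomes dependent when `a` is added. If the dependence singles
    -- out some `b ≠ a`, exchange moves it to `a`.
    have hind := (hε.2 _ hGI).2 (hQ.isForest hxy)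
    simp only [IndepHyperplanes, not_forall, not_not] at hdep
    obtain ⟨G₀, hG₀, hfin₀, b, hb, hsub⟩ := hdep
    have hGfin := hfin.subset hGF
    refine (anti hGF).trans ?_
    by_cases hba : b = a
    · subst hba
      refine (anti ?_).trans hsub
      rintro c ⟨hc, hcb⟩
      exact (hG₀ hc).resolve_left hcb
    have hbG : b ∈ G := (hG₀ hb).resolve_left hba
    have h1 : ¬ A.hInf ∩ ⋂₀ (G \ {b}) ⊆ b := hind G subset_rfl hGfin b hbG
    have h2 : A.hInf ∩ ⋂₀ (insert a (G \ {b})) ⊆ b := by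
      refine (anti ?_).trans hsub
      rintro c ⟨hc, hcb⟩
      rcases hG₀ hc with rfl | hcG
      · exact Set.mem_insert _ _
      · exact Or.inr ⟨hcG, hcb⟩
    have h3 := ideal_exchange (Set.sdiff_subset.trans hGI) ha (hGI hbG) h1 h2
    rwa [Set.insert_sdiff_singleton, Set.insert_eq_of_mem hbG] at h3

theorem IsGraphicVia.tP_subset_iff_mem_clos_of_finite (hε : 𝒜.IsGraphicVia Δ ε)
    (hΔ : ∀ b x, ¬ Δ.IsLink b x x) {S : Set E} (hS : S.Finite) (e : E) :
    𝒜.tP (insert none (some '' S)) ⊆ 𝒜.hP (some e) ↔ e ∈ (𝒜.omegaGraph Δ ε).clos S := by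
  rw [tP_ideal_subset_iff, hε.subset_iff_mem_clos hΔ (Set.image_subset_range _ _) (hS.image _)
    (Set.mem_range_self e), omegaGraph,
    Graph.mem_clos_pullback (p := fun e => ε (𝒜.ideal e)) hΔ (hε.1.mapsTo (Set.mem_range_self e)),
    Set.image_image]

/-- Contraction of the ideal hyperplane gives the graphic matroid of `Ω(𝒜)`. -/
theorem IsGraphicVia.tP_subset_iff_mem_clos (hε : 𝒜.IsGraphicVia Δ ε)
    (hΔ : ∀ b x, ¬ Δ.IsLink b x x) {S : Set E} (hS : S.Finite ∨ 𝒜.Finitary) (e : E) :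
    𝒜.tP (insert none (some '' S)) ⊆ 𝒜.hP (some e) ↔ e ∈ (𝒜.omegaGraph Δ ε).clos S := by
  rcases hS with hS | hfin
  · exact hε.tP_subset_iff_mem_clos_of_finite hΔ hS e
  constructor
  · intro h
    obtain ⟨F, hFS, hF, hFe⟩ := hfin _ _ h
    -- `F` need not contain `none`, but adding it only shrinks the intersection.
    refine Graph.clos_mono (S := some ⁻¹' F) ?_
      ((hε.tP_subset_iff_mem_clos_of_finite hΔ ?_ e).1 ((𝒜.tP_anti ?_).trans hFe))
    · intro f hf
      obtain h | ⟨g, hg, hgf⟩ := hFS hf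
      · exact absurd h (by simp)
      · exact Option.some_injective _ hgf ▸ hg
    · exact hF.preimage (Option.some_injective _).injOn
    · rintro (_ | f) hf
      · exact Or.inl rfl
      · exact Or.inr ⟨f, hf, rfl⟩
  · intro h
    obtain ⟨F, hFS, hF, hFe⟩ := Graph.exists_finite_of_mem_clos h
    exact (𝒜.tP_anti (Set.insert_subset_insert (Set.image_mono hFS))).trans
      ((hε.tP_subset_iff_mem_clos_of_finite hΔ hF e).2 hFe)

/-! ### Balance and the extended lift matroid -/

theorem IsGraphicVia.tP_sdiff_subset_of_isCircle (hε : 𝒜.IsGraphicVia Δ ε)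
    (hΔ : ∀ b x, ¬ Δ.IsLink b x x) {C : Set E} (hC : (𝒜.omegaGraph Δ ε).IsCircle C)
    (h0 : ¬ 𝒜.tP (some '' C) ⊆ 𝒜.hP none) {r : E} (hr : r ∈ C) :
    𝒜.tP (some '' (C \ {r})) ⊆ 𝒜.hP (some r) := by
  -- Together with `none`, the rest of the circle spans `r`. If it did not span `r` alone, exchange
  -- would make the whole circle span `none`.
  by_contra hcon
  have h1 := (hε.tP_subset_iff_mem_clos_of_finite hΔ (hC.finite.subset Set.sdiff_subset) r).2
    (hC.mem_clos hr)
  have h2 := 𝒜.tP_exchange hcon h1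
  rw [← Set.image_insert_eq, Set.insert_sdiff_singleton, Set.insert_eq_of_mem hr] at h2
  exact h0 h2

/-- The exclusion of digons is automatic: in a digon with nonempty intersection one hyperplane would
contain the other, and distinct hyperplanes are incomparable. -/
theorem IsGraphicVia.mem_omegaBalanced_iff (hε : 𝒜.IsGraphicVia Δ ε)
    (hΔ : ∀ b x, ¬ Δ.IsLink b x x) {C : Set E} :
    C ∈ 𝒜.omegaBalanced Δ ε ↔
      (𝒜.omegaGraph Δ ε).IsCircle C ∧ ¬ 𝒜.tP (some '' C) ⊆ 𝒜.hP none := by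
  rw [← tA_nonempty_iff]
  refine ⟨fun h => ⟨h.1, h.2.2⟩, fun h => ⟨h.1, fun h2 => ?_, h.2⟩⟩
  obtain ⟨a, b, hab, rfl⟩ := Set.encard_eq_two.1 h2
  have := hε.tP_sdiff_subset_of_isCircle hΔ h.1 ((𝒜.tA_nonempty_iff _).1 h.2)
    (Set.mem_insert a ({b} : Set E))
  rw [Set.insert_sdiff_self_of_notMem (Set.notMem_singleton_iff.2 hab), Set.image_singleton, tP, Set.biInter_singleton] at this
  exact hab.symm (Option.some_injective _ (𝒜.eq_of_hP_subset this))

theorem not_isLink_self_omegaGraph (hΔ : ∀ b x, ¬ Δ.IsLink b x x) (e : E) (x : N) :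
    ¬ (𝒜.omegaGraph Δ ε).IsLink e x x := hΔ _ x

theorem IsGraphicVia.tP_subset_of_mem_bcl (hε : 𝒜.IsGraphicVia Δ ε)
    (hΔ : ∀ b x, ¬ Δ.IsLink b x x) {S : Set E} {e : E}
    (he : e ∈ Graph.bcl (𝒜.omegaBalanced Δ ε) S) : 𝒜.tP (some '' S) ⊆ 𝒜.hP (some e) := by
  rcases he with he | ⟨C, hC, heC, hCS⟩
  · exact 𝒜.tP_subset_hP ⟨e, he, rfl⟩
  · obtain ⟨h1, h2⟩ := (hε.mem_omegaBalanced_iff hΔ).1 hC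
    refine (𝒜.tP_anti (Set.image_mono ?_)).trans (hε.tP_sdiff_subset_of_isCircle hΔ h1 h2 heC)
    rintro f ⟨hf, hfe⟩
    exact (hCS hf).resolve_right hfe

/-- If `e` were the first edge to force the intersection into `hInf`, exchange would put `e` in the
graphic closure of `S`. The resulting circle is balanced, so `hP (some e)` already contains `tP
(some '' S)` and adding `e` changes nothing. -/
theorem IsGraphicVia.not_tP_subset_of_balanced (hε : 𝒜.IsGraphicVia Δ ε)
    (hΔ : ∀ b x, ¬ Δ.IsLink b x x) {S : Set E} (hS : S.Finite)
    (hb : (𝒜.omegaGraph Δ ε).Balanced (𝒜.omegaBalanced Δ ε) S) :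
    ¬ 𝒜.tP (some '' S) ⊆ 𝒜.hP none := by
  induction S, hS using Set.Finite.induction_on with
  | empty =>
    rw [Set.image_empty, tP, Set.biInter_empty, Set.univ_subset_iff]
    exact A.isHyperplane_hInf.2.1
  | @insert e S he hS ih =>
    have ih := ih fun C hC => hb C (hC.trans (Set.subset_insert _ _))
    intro h
    rw [Set.image_insert_eq] at h
    have h1 := (hε.tP_subset_iff_mem_clos_of_finite hΔ hS e).1 (𝒜.tP_exchange ih h)
    obtain ⟨C, hC, heC, hCS⟩ :=
      Graph.exists_isCircle_of_mem_clos (not_isLink_self_omegaGraph hΔ) h1 he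
    have h2 := hε.tP_subset_of_mem_bcl hΔ (S := S)
      (Or.inr ⟨C, hb C (by rwa [← Set.union_singleton]) hC, heC, hCS⟩)
    refine ih (fun p hp => h ?_)
    rw [tP_insert]
    exact ⟨h2 hp, hp⟩

/-- The intersection of a subfamily is nonempty if and only if its edge set is balanced. -/
theorem IsGraphicVia.tA_nonempty_iff_balanced (hε : 𝒜.IsGraphicVia Δ ε)
    (hΔ : ∀ b x, ¬ Δ.IsLink b x x) {S : Set E} (hS : S.Finite ∨ 𝒜.Finitary) :
    (𝒜.tA S).Nonempty ↔ (𝒜.omegaGraph Δ ε).Balanced (𝒜.omegaBalanced Δ ε) S := by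
  rw [tA_nonempty_iff]
  constructor
  · intro h C hCS hC
    exact (hε.mem_omegaBalanced_iff hΔ).2
      ⟨hC, fun h' => h ((𝒜.tP_anti (Set.image_mono hCS)).trans h')⟩
  · intro hb
    rcases hS with hS | hfin
    · exact hε.not_tP_subset_of_balanced hΔ hS hb
    · intro h
      obtain ⟨F, hFS, hF, hF0⟩ := hfin _ _ h
      obtain ⟨G, hGS, rfl⟩ := Set.subset_image_iff.1 hFS
      exact hε.not_tP_subset_of_balanced hΔ
        (hF.of_finite_image (Option.some_injective _).injOn)
        (fun C hC => hb C (hC.trans hGS)) hF0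

theorem IsGraphicVia.tP_subset_iff_mem_bcl (hε : 𝒜.IsGraphicVia Δ ε)
    (hΔ : ∀ b x, ¬ Δ.IsLink b x x) {S : Set E} (hS : S.Finite ∨ 𝒜.Finitary)
    (hb : (𝒜.omegaGraph Δ ε).Balanced (𝒜.omegaBalanced Δ ε) S) (e : E) :
    𝒜.tP (some '' S) ⊆ 𝒜.hP (some e) ↔ e ∈ Graph.bcl (𝒜.omegaBalanced Δ ε) S := by
  refine ⟨fun h => ?_, hε.tP_subset_of_mem_bcl hΔ⟩
  by_cases he : e ∈ S
  · exact Or.inl he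
  have h1 := (hε.tP_subset_iff_mem_clos hΔ hS e).1
    ((𝒜.tP_anti (Set.subset_insert none (some '' S))).trans h)
  obtain ⟨C, hC, heC, hCS⟩ :=
    Graph.exists_isCircle_of_mem_clos (not_isLink_self_omegaGraph hΔ) h1 he
  -- Adding `e` leaves the intersection of `S` unchanged, hence not inside `hInf`; so the circle `C
  -- ⊆ S ∪ {e}` is balanced.
  refine Or.inr ⟨C, (hε.mem_omegaBalanced_iff hΔ).2 ⟨hC, fun h0 => ?_⟩, heC, hCS⟩
  rw [← hε.tA_nonempty_iff_balanced hΔ hS, tA_nonempty_iff] at hb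
  refine hb (fun p hp => h0 (𝒜.tP_anti (Set.image_mono hCS) ?_))
  rw [Set.union_singleton, Set.image_insert_eq, tP_insert]
  exact ⟨h hp, hp⟩

/-- The closure operator of the matroid of `𝒜_ℙ` is that of the extended lift matroid. -/
theorem IsGraphicVia.tP_subset_iff_mem_closL0 (hε : 𝒜.IsGraphicVia Δ ε)
    (hΔ : ∀ b x, ¬ Δ.IsLink b x x) {S : Set (Option E)} (hS : S.Finite ∨ 𝒜.Finitary)
    (x : Option E) :
    𝒜.tP S ⊆ 𝒜.hP x ↔ x ∈ (𝒜.omegaGraph Δ ε).closL0 (𝒜.omegaBalanced Δ ε) S := by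
  have hS' : (some ⁻¹' S).Finite ∨ 𝒜.Finitary :=
    hS.imp_left fun h => h.preimage (Option.some_injective _).injOn
  have hsome : none ∉ S → some '' (some ⁻¹' S) = S := fun hn => by
    ext (_ | e) <;> simp [hn]
  unfold Graph.closL0
  split_ifs with h
  · obtain ⟨hn, hb⟩ := h
    rw [← hsome hn, Set.preimage_image_eq _ (Option.some_injective _)]
    rcases x with _ | e
    · rw [← hε.tA_nonempty_iff_balanced hΔ hS', tA_nonempty_iff] at hb
      simp [hb]
    · rw [hε.tP_subset_iff_mem_bcl hΔ hS' hb, (Option.some_injective _).mem_set_image]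
  · have h0 : 𝒜.tP S ⊆ 𝒜.hP none := by
      by_cases hn : none ∈ S
      · exact 𝒜.tP_subset_hP hn
      · have hb : ¬ (𝒜.tA (some ⁻¹' S)).Nonempty := fun hb =>
          h ⟨hn, (hε.tA_nonempty_iff_balanced hΔ hS').1 hb⟩
        rwa [tA_nonempty_iff, hsome hn, not_not] at hb
    -- The closure already contains `none`, so `none` can be adjoined and the graphic description
    -- applies.
    have h1 : 𝒜.tP S = 𝒜.tP (insert none (some '' (some ⁻¹' S))) := by
      have : insert none (some '' (some ⁻¹' S)) = insert none S := by
        ext (_ | e) <;> simp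
      rw [this, tP_insert, Set.inter_eq_right.2 h0]
    rcases x with _ | e
    · simp [h0]
    · rw [h1, hε.tP_subset_iff_mem_clos hΔ hS']
      simp

/-- `Ω(𝒜)` is a biased graph. -/
theorem IsGraphicVia.isBiased (hε : 𝒜.IsGraphicVia Δ ε) (hΔ : ∀ b x, ¬ Δ.IsLink b x x) :
    (𝒜.omegaGraph Δ ε).IsBiased (𝒜.omegaBalanced Δ ε) := by
  refine ⟨fun C hC => hC.1, fun X Y Z hT hXY hYZ => ?_⟩
  obtain ⟨x, y, U, V, W, hxy, hX, hY, hZ, hUV, hVW, hUW, -, -, hXZ⟩ := hT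
  have hC := hX.isCircle_union hZ hxy hUW.subset hXZ
  have hWU : W ∩ (U ∪ V) ⊆ {x, y} := by
    rintro z ⟨hzW, hz | hz⟩
    · exact hUW.subset ⟨hz, hzW⟩
    · exact hVW.subset ⟨hz, hzW⟩
  obtain ⟨n, w, f, hn, hw, hw0, hwn, hl, hW, hZf⟩ := hZ.exists_nat hxy
  have hf := Graph.injOn_edges_of_nat_path hw hl
  have hloop := not_isLink_self_omegaGraph (𝒜 := 𝒜) (ε := ε) hΔ
  -- each edge of the third path except the last leads to a new node, so it creates no circle
  have step : ∀ i < n, ¬ 𝒜.tP (some '' (X ∪ Y ∪ f '' Set.Iio i)) ⊆ 𝒜.hP none := by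
    intro i
    induction i with
    | zero =>
      intro _
      have : f '' Set.Iio 0 = ∅ := by simp
      rw [this, Set.union_empty]
      exact ((hε.mem_omegaBalanced_iff hΔ).1 hXY).2
    | succ i ih =>
      intro hi h
      have hins : X ∪ Y ∪ f '' Set.Iio (i + 1) = insert (f i) (X ∪ Y ∪ f '' Set.Iio i) := by
        rw [Set.Iio_add_one_eq_Iic, ← Set.Iio_insert, Set.image_insert_eq, Set.union_insert]
      rw [hins, Set.image_insert_eq] at h
      have h1 := 𝒜.tP_exchange (ih (by omega)) h
      rw [hε.tP_subset_iff_mem_clos_of_finite hΔ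
        ((hX.finite.union hY.finite).union ((Set.finite_Iio i).image f))] at h1
      have hli := hl i (by omega)
      have hne : w i ≠ w (i + 1) := fun h => hloop _ _ (h ▸ hli)
      have hnew : w (i + 1) ∉ U ∪ V := by
        intro hmem
        rcases hWU ⟨hW ▸ ⟨i + 1, hi.le, rfl⟩, hmem⟩ with h | h
        · have := hw (Set.mem_Iic.2 hi.le) (Set.mem_Iic.2 n.zero_le) (h.trans hw0.symm)
          omega
        · have h : w (i + 1) = y := h
          have := hw (Set.mem_Iic.2 hi.le) (Set.mem_Iic.2 le_rfl) (h.trans hwn.symm)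
          omega
      refine Graph.notMem_clos_of_forall_not_isLink hli hne ?_ h1
      rintro e ((he | he) | ⟨j, hj, rfl⟩) z hz
      · exact hnew (Or.inl (hX.left_mem he hz))
      · exact hnew (Or.inr (hY.left_mem he hz))
      · have hj : j < i := hj
        rcases hz.left_eq_or_eq (hl j (by omega)) with h | h
        · have := hw (Set.mem_Iic.2 (by omega)) (Set.mem_Iic.2 (by omega)) h
          omega
        · have := hw (Set.mem_Iic.2 (by omega)) (Set.mem_Iic.2 (by omega)) h
          omega
  refine (hε.mem_omegaBalanced_iff hΔ).2 ⟨hC, fun h => step (n - 1) (by omega) ?_⟩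
  obtain ⟨hYZc, hYZ0⟩ := (hε.mem_omegaBalanced_iff hΔ).1 hYZ
  -- The last edge returns to the old node `y`, but its hyperplane contains the intersection of the
  -- other edges of the balanced circle `Y ∪ Z`. Adding it therefore does not change the
  -- intersection.
  have hlast := hε.tP_sdiff_subset_of_isCircle hΔ hYZc hYZ0 (r := f (n - 1))
    (Or.inr (hZf ▸ ⟨n - 1, Set.mem_Iio.2 (by omega), rfl⟩))
  have hcover : Z ⊆ insert (f (n - 1)) (f '' Set.Iio (n - 1)) := by
    rw [hZf, ← Set.image_insert_eq, Set.Iio_insert]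
    exact Set.image_mono fun i hi => Set.mem_Iic.2 (by have : i < n := hi; omega)
  intro p hp
  have hp1 : p ∈ 𝒜.hP (some (f (n - 1))) := by
    refine hlast (𝒜.tP_anti (Set.image_mono ?_) hp)
    rintro e ⟨he | he, hne⟩
    · exact Or.inl (Or.inr he)
    · exact Or.inr ((hcover he).resolve_left hne)
  have hp2 : p ∈ 𝒜.tP (insert (some (f (n - 1))) (some '' (X ∪ Y ∪ f '' Set.Iio (n - 1)))) := by
    rw [tP_insert]
    exact ⟨hp1, hp⟩
  refine h (𝒜.tP_anti ?_ hp2)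
  rw [← Set.image_insert_eq]
  refine Set.image_mono ?_
  rintro e (he | he)
  · exact Or.inr (Or.inl (Or.inl he))
  · rcases hcover he with h | h
    · exact Or.inl h
    · exact Or.inr (Or.inr h)

/-! ### The intersection semilattice and lattice -/

theorem tA_setOf_subset {t : Set P} (ht : t ∈ 𝒜.affineFlats) : 𝒜.tA {e | t ⊆ 𝒜.h e} = t := by
  obtain ⟨-, S, rfl⟩ := ht
  -- The hyperplanes that contain `t` include those of any family that defines it, so they form the
  -- largest such family.
  refine Set.Subset.antisymm ?_ (Set.subset_inter Set.inter_subset_left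
    (Set.subset_iInter₂ fun e he => he))
  exact Set.inter_subset_inter_right _ (Set.biInter_subset_biInter_left fun e he =>
    Set.inter_subset_right.trans (Set.biInter_subset_of_mem he))

theorem tP_setOf_subset {t : Set P} (ht : t ∈ 𝒜.projFlats) : 𝒜.tP {x | t ⊆ 𝒜.hP x} = t := by
  obtain ⟨S, rfl⟩ := ht
  exact (𝒜.tP_anti fun x hx => 𝒜.tP_subset_hP hx).antisymm
    (Set.subset_iInter₂ fun e he => he)

theorem IsGraphicVia.setOf_tA_subset (hε : 𝒜.IsGraphicVia Δ ε) (hΔ : ∀ b x, ¬ Δ.IsLink b x x)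
    (hfin : 𝒜.Finitary) {S : Set E}
    (hb : (𝒜.omegaGraph Δ ε).Balanced (𝒜.omegaBalanced Δ ε) S) :
    {e | 𝒜.tA S ⊆ 𝒜.h e} = Graph.bcl (𝒜.omegaBalanced Δ ε) S := by
  ext e
  exact (tA_subset_h_iff 𝒜 ((hε.tA_nonempty_iff_balanced hΔ (Or.inr hfin)).2 hb) e).trans
    (hε.tP_subset_iff_mem_bcl hΔ (Or.inr hfin) hb e)

/-- The intersection semilattice of `𝒜` is isomorphic to the semilattice of closed, balanced
edge sets. -/
def IsGraphicVia.affineFlatsIso (hε : 𝒜.IsGraphicVia Δ ε) (hΔ : ∀ b x, ¬ Δ.IsLink b x x)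
    (hfin : 𝒜.Finitary) :
    (𝒜.affineFlats)ᵒᵈ ≃o (𝒜.omegaGraph Δ ε).LatB (𝒜.omegaBalanced Δ ε) where
  toFun t := ⟨{e | (OrderDual.ofDual t).1 ⊆ 𝒜.h e}, by
    have ht := (OrderDual.ofDual t).2
    have hb := (hε.tA_nonempty_iff_balanced hΔ (Or.inr hfin)).1
      ((tA_setOf_subset ht).symm ▸ ht.1)
    refine ⟨hb, ?_⟩
    rw [← hε.setOf_tA_subset hΔ hfin hb, tA_setOf_subset ht]⟩
  invFun S := OrderDual.toDual
    ⟨𝒜.tA S, (hε.tA_nonempty_iff_balanced hΔ (Or.inr hfin)).2 S.2.1, S, rfl⟩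
  left_inv t := congrArg OrderDual.toDual (Subtype.ext (tA_setOf_subset (OrderDual.ofDual t).2))
  right_inv S := Subtype.ext ((hε.setOf_tA_subset hΔ hfin S.2.1).trans S.2.2)
  map_rel_iff' {t u} := by
    constructor
    · intro h
      have h : {e | (OrderDual.ofDual t).1 ⊆ 𝒜.h e} ⊆
        {e | (OrderDual.ofDual u).1 ⊆ 𝒜.h e} := h
      change (OrderDual.ofDual u).1 ⊆ (OrderDual.ofDual t).1
      rw [← tA_setOf_subset (OrderDual.ofDual t).2, ← tA_setOf_subset (OrderDual.ofDual u).2]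
      exact Set.inter_subset_inter_right _ (Set.biInter_subset_biInter_left h)
    · intro h e he
      exact Set.Subset.trans (show (OrderDual.ofDual u).1 ⊆ (OrderDual.ofDual t).1 from h) he

/-- The intersection lattice of `𝒜_ℙ` is isomorphic to the lattice of closed sets of the
extended lift matroid. -/
def IsGraphicVia.projFlatsIso (hε : 𝒜.IsGraphicVia Δ ε) (hΔ : ∀ b x, ¬ Δ.IsLink b x x)
    (hfin : 𝒜.Finitary) :
    (𝒜.projFlats)ᵒᵈ ≃o (𝒜.omegaGraph Δ ε).LatL0 (𝒜.omegaBalanced Δ ε) where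
  toFun t := ⟨{x | (OrderDual.ofDual t).1 ⊆ 𝒜.hP x}, by
    ext x
    rw [← hε.tP_subset_iff_mem_closL0 hΔ (Or.inr hfin), tP_setOf_subset (OrderDual.ofDual t).2]
    rfl⟩
  invFun S := OrderDual.toDual ⟨𝒜.tP S, S, rfl⟩
  left_inv t := congrArg OrderDual.toDual (Subtype.ext (tP_setOf_subset (OrderDual.ofDual t).2))
  right_inv S := Subtype.ext (by
    ext x
    exact (hε.tP_subset_iff_mem_closL0 hΔ (Or.inr hfin) x).trans (Set.ext_iff.1 S.2 x))
  map_rel_iff' {t u} := by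
    constructor
    · intro h
      have h : {x | (OrderDual.ofDual t).1 ⊆ 𝒜.hP x} ⊆
        {x | (OrderDual.ofDual u).1 ⊆ 𝒜.hP x} := h
      change (OrderDual.ofDual u).1 ⊆ (OrderDual.ofDual t).1
      rw [← tP_setOf_subset (OrderDual.ofDual t).2, ← tP_setOf_subset (OrderDual.ofDual u).2]
      exact 𝒜.tP_anti h
    · intro h x hx
      exact Set.Subset.trans (show (OrderDual.ofDual u).1 ⊆ (OrderDual.ofDual t).1 from h) hx

end HyperplaneArrangement

theorem theoremT {P E N B : Type*} (A : AffineGeometry P) (𝒜 : HyperplaneArrangement A E)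
    (Δ : Graph N B) (hΔ : Δ.Loopless) (ε : Set P → B) (hε : 𝒜.IsGraphicVia Δ ε) :
    -- `Ω(𝒜)` is a biased graph
    (𝒜.omegaGraph Δ ε).IsBiased (𝒜.omegaBalanced Δ ε) ∧
    -- a finite subfamily has nonempty intersection if and only if its edge set is balanced
    (∀ S : Set E, S.Finite →
      ((𝒜.tA S).Nonempty ↔ (𝒜.omegaGraph Δ ε).Balanced (𝒜.omegaBalanced Δ ε) S)) ∧
    -- the finitary matroid of `𝒜_ℙ` is the extended lift matroid of `Ω(𝒜)`
    (∀ S : Set (Option E), S.Finite → ∀ x : Option E,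
      𝒜.tP S ⊆ 𝒜.hP x ↔ x ∈ (𝒜.omegaGraph Δ ε).closL0 (𝒜.omegaBalanced Δ ε) S) ∧
    -- the statements about arbitrary, possibly infinite, subfamilies
    (𝒜.Finitary →
      (∀ S : Set E,
        (𝒜.tA S).Nonempty ↔ (𝒜.omegaGraph Δ ε).Balanced (𝒜.omegaBalanced Δ ε) S) ∧
      (∃ φ : (𝒜.affineFlats)ᵒᵈ ≃o (𝒜.omegaGraph Δ ε).LatB (𝒜.omegaBalanced Δ ε),
        (∀ t : 𝒜.affineFlats, (φ (OrderDual.toDual t) : Set E) = {e | (t : Set P) ⊆ 𝒜.h e}) ∧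
        ∀ S : (𝒜.omegaGraph Δ ε).LatB (𝒜.omegaBalanced Δ ε),
          ((OrderDual.ofDual (φ.symm S) : 𝒜.affineFlats) : Set P) = 𝒜.tA S) ∧
      (∃ ψ : (𝒜.projFlats)ᵒᵈ ≃o (𝒜.omegaGraph Δ ε).LatL0 (𝒜.omegaBalanced Δ ε),
        (∀ t : 𝒜.projFlats,
          (ψ (OrderDual.toDual t) : Set (Option E)) = {x | (t : Set P) ⊆ 𝒜.hP x}) ∧
        ∀ S : (𝒜.omegaGraph Δ ε).LatL0 (𝒜.omegaBalanced Δ ε),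
          ((OrderDual.ofDual (ψ.symm S) : 𝒜.projFlats) : Set P) = 𝒜.tP S)) := by
  have hΔ' : ∀ b x, ¬ Δ.IsLink b x x := fun b x => hΔ.not_isLoopAt b x
  refine ⟨hε.isBiased hΔ', fun S hS => hε.tA_nonempty_iff_balanced hΔ' (Or.inl hS),
    fun S hS x => hε.tP_subset_iff_mem_closL0 hΔ' (Or.inl hS) x, fun hfin =>
    ⟨fun S => hε.tA_nonempty_iff_balanced hΔ' (Or.inr hfin),
      ⟨hε.affineFlatsIso hΔ' hfin, fun t => rfl, fun S => rfl⟩,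
      ⟨hε.projFlatsIso hΔ' hfin, fun t => rfl, fun S => rfl⟩⟩⟩
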